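/- Let $n_1,n_2,n_3\ge 2$, $1\le r\le\min\{n_1,n_2\}$ and $4\le m\le n_1n_2n_3$ be integers, let $b,c,\tau>0$, and write $x\vee y=\max\{x,y\}$. The tensor-tensor product $\mathcal A\diamond\mathcal B\in\mathbb R^{n_1\times n_2\times n_3}$ of $\mathcal A\in\mathbb R^{n_1\times r\times n_3}$ and $\mathcal B\in\mathbb R^{r\times n_2\times n_3}$ is obtained by multiplying the block circulant matrix whose first block column consists of the frontal slices of $\mathcal A$ with the stacked frontal slices of $\mathcal B$, i.e. $(\mathcal A\diamond\mathcal B)_{ijk}=\sum_{s=1}^{n_3}\sum_{l=1}^{r}\mathcal A_{il,\,k-s+1}\,\mathcal B_{ljs}$ with the third index of $\mathcal A$ taken modulo $n_3$. $\|\cdot\|_0$ denotes the number of nonzero entries and $\|\cdot\|_F$ the Frobenius norm of a tensor. Let $\mathcal X^*=\mathcal A^*\diamond\mathcal B^*\in\mathbb R^{n_1\times n_2\times n_3}$ with $\mathcal A^*\in\mathbb R^{n_1\times r\times n_3}$, $\mathcal B^*\in\mathbb R^{r\times n_2\times n_3}$, $0\le\mathcal X^*_{ijk}\le c/2$, $0\le\mathcal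 A^*_{ijk}\le 1$ and $0\le\mathcal B^*_{ijk}\le b$ for all $i,j,k$. Let $\Omega\sim\mathrm{Bern}(\gamma)$ with $\gamma=\frac{m}{n_1n_2n_3}$, i.e. every index $(i,j,k)$ belongs to $\Omega$ independently with probability $\gamma$. Suppose that one observes $\Omega$ and $$\mathcal Y_{ijk}=\mathcal X^*_{ijk}+\epsilon_{ijk},\qquad (i,j,k)\in\Omega,$$ where the $\epsilon_{ijk}$ are independent of each other and of $\Omega$ and have the Laplace$(0,\tau)$ distribution, with density $\frac1{2\tau}e^{-|x|/\tau}$. Put $$\beta=\max\Big\{3,\,1+\frac{\log(3rn_3^{1.5}b/c)}{\log(n_1\vee n_2)}\Big\},\qquad \kappa=\frac{c^2}{2\tau^2},\qquad \lambda=4(\beta+2)\Big(1+\frac{2\kappa}3\Big)\log(n_1\vee n_2),\qquad \vartheta=2^{\lceil\beta\log_2(n_1\vee n_2)\rceil}.$$ Divide each of $[0,1]$ and $[0,b]$ into $\vartheta$ bins of equal size and fix one value in each (closed) bin. Let $\mathfrak L$ be the set of all tensors $\mathcal A\in\mathbb R_+^{n_1\times r\times n_3}$ whose entries are bin values of $[0,1]$,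 let $\mathfrak D$ be the set of all tensors $\mathcal B\in\mathbb R_+^{r\times n_2\times n_3}$ each entry of which either is $0$ or is a bin value of $[0,b]$, and let $$\Gamma=\{\mathcal X=\mathcal A\diamond\mathcal B:\ \mathcal A\in\mathfrak L,\ \mathcal B\in\mathfrak D,\ 0\le\mathcal X_{ijk}\le c\ \text{for all } i,j,k\}.$$ Then every (measurable) estimator $$\widetilde{\mathcal X}^\lambda\in\arg\min_{\mathcal X=\mathcal A\diamond\mathcal B\in\Gamma}\Big\{-\log\prod_{(i,j,k)\in\Omega}\frac1{2\tau}e^{-|\mathcal Y_{ijk}-\mathcal X_{ijk}|/\tau}+\lambda\|\mathcal B\|_0\Big\}$$ satisfies $$\frac{\mathbb E_{\Omega,\mathcal Y_\Omega}\big[\|\widetilde{\mathcal X}^\lambda-\mathcal X^*\|_F^2\big]}{n_1n_2n_3}\le\frac{3c^2(2\tau+c)^2\log(m)}{m\tau^2}+2\Big(3+\frac{c^2}{\tau^2}\Big)(2\tau+c)^2(\beta+2)\Big(\frac{rn_1n_3+\|\mathcal B^*\|_0}{m}\Big)\log(n_1\vee n_2).$$ -/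

import Mathlib

namespace SparseNTF

open MeasureTheory

/-- Real third-order tensors of size `n₁ × n₂ × n₃`. -/
abbrev Tensor (n₁ n₂ n₃ : ℕ) : Type := Fin n₁ → Fin n₂ → Fin n₃ → ℝ

/-- The index set of an `n₁ × n₂ × n₃` tensor. -/
abbrev Index (n₁ n₂ n₃ : ℕ) : Type := Fin n₁ × Fin n₂ × Fin n₃

/-- The `k`-th frontal slice, an `n₁ × n₂` matrix. -/
def frontalSlice {n₁ n₂ n₃ : ℕ} (X : Tensor n₁ n₂ n₃) (k : Fin n₃) :
    Matrix (Fin n₁) (Fin n₂) ℝ :=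
  Matrix.of fun i j => X i j k

/-- The frontal slices stacked on top of each other; the row index `(k, i)` is row `i` of the
`k`-th block. -/
def unfold {n₁ n₂ n₃ : ℕ} (X : Tensor n₁ n₂ n₃) :
    Matrix (Fin n₃ × Fin n₁) (Fin n₂) ℝ :=
  Matrix.of fun q j => frontalSlice X q.1 q.2 j

/-- The inverse operation of `unfold`. -/
def fold {n₁ n₂ n₃ : ℕ} (M : Matrix (Fin n₃ × Fin n₁) (Fin n₂) ℝ) : Tensor n₁ n₂ n₃ :=
  fun i j k => M (k, i) j

/-- The block circulant matrix whose first block column is `M`: its block in position `(k, s)`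
is the block number `k - s` (mod `n₃`, blocks being numbered from `0`) of `M`. -/
def circ {n₁ n₂ n₃ : ℕ} (M : Matrix (Fin n₃ × Fin n₁) (Fin n₂) ℝ) :
    Matrix (Fin n₃ × Fin n₁) (Fin n₃ × Fin n₂) ℝ :=
  Matrix.of fun p q => M (p.1 - q.1, p.2) q.2

/-- The tensor-tensor product. -/
def tensorProd {n₁ n₂ n₃ n₄ : ℕ} (X : Tensor n₁ n₂ n₃) (Y : Tensor n₂ n₄ n₃) : Tensor n₁ n₄ n₃ :=
  fold (circ (unfold X) * unfold Y)

/-- The inner product of two tensors. -/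
def tensorInner {n₁ n₂ n₃ : ℕ} (X Y : Tensor n₁ n₂ n₃) : ℝ :=
  ∑ k, ((frontalSlice X k).transpose * frontalSlice Y k).trace

/-- The tensor Frobenius norm. -/
noncomputable def frobNorm {n₁ n₂ n₃ : ℕ} (X : Tensor n₁ n₂ n₃) : ℝ :=
  Real.sqrt (tensorInner X X)

/-- The tensor `ℓ₀` norm: the number of nonzero entries. -/
noncomputable def l0Norm {n₁ n₂ n₃ : ℕ} (X : Tensor n₁ n₂ n₃) : ℕ :=
  Set.ncard {q : Index n₁ n₂ n₃ | X q.1 q.2.1 q.2.2 ≠ 0}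

/-- The density of the Laplace distribution with location `μ` and diversity `τ`. -/
noncomputable def laplacePDF (μ τ y : ℝ) : ℝ :=
  1 / (2 * τ) * Real.exp (-|y - μ| / τ)

/-- The Laplace distribution with location `μ` and diversity `τ`. -/
noncomputable def laplaceMeasure (μ τ : ℝ) : Measure ℝ :=
  volume.withDensity fun y => ENNReal.ofReal (laplacePDF μ τ y)

open Classical in
/-- The joint Laplace density of the observations: it depends only on the entries of `Y` in the
set `S` of observed locations. -/
noncomputable def jointDensity {n₁ n₂ n₃ : ℕ} (τ : ℝ) (S : Set (Index n₁ n₂ n₃))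
    (X Y : Tensor n₁ n₂ n₃) : ℝ :=
  ∏ q : Index n₁ n₂ n₃ with q ∈ S, laplacePDF (X q.1 q.2.1 q.2.2) τ (Y q.1 q.2.1 q.2.2)

/-- The parameter `β = max {3, 1 + log (3 r n₃^{1.5} b / c) / log (n₁ ∨ n₂)}`. -/
noncomputable def betaParam (n₁ n₂ n₃ r : ℕ) (b c : ℝ) : ℝ :=
  max 3 (1 + Real.log (3 * r * (n₃ : ℝ) ^ (3 / 2 : ℝ) * b / c) / Real.log (max n₁ n₂ : ℕ))

/-- The number of bins `ϑ = 2^⌈β log₂ (n₁ ∨ n₂)⌉`. -/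
noncomputable def numBins (n₁ n₂ : ℕ) (β : ℝ) : ℕ :=
  2 ^ ⌈β * Real.logb 2 (max n₁ n₂ : ℕ)⌉₊

/-- The regularization parameter `λ = 4 (β + 2) (1 + 2 κ / 3) log (n₁ ∨ n₂)`. -/
noncomputable def lambdaParam (n₁ n₂ : ℕ) (β κ : ℝ) : ℝ :=
  4 * (β + 2) * (1 + 2 * κ / 3) * Real.log (max n₁ n₂ : ℕ)

/-- `v` lists the values representing the bins when the range `[0, u]` is divided into `t` bins of
equal size: the value `v k` lies in the `k`-th bin. (Left ends, midpoints, right ends, and the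
`t` equispaced levels from `0` to `u` all are such lists.) -/
def IsBinValues (u : ℝ) (t : ℕ) (v : Fin t → ℝ) : Prop :=
  ∀ k : Fin t, u * k / t ≤ v k ∧ v k ≤ u * (k + 1) / t

/-- The set `𝔏` of tensors whose entries all are bin values. -/
def factorsA (n₁ r n₃ : ℕ) {t : ℕ} (v : Fin t → ℝ) : Set (Tensor n₁ r n₃) :=
  {A | ∀ i j k, A i j k ∈ Set.range v}

/-- The set `𝔇` of tensors whose entries either are `0` or are bin values. -/
def factorsB (r n₂ n₃ : ℕ) {t : ℕ} (v : Fin t → ℝ) : Set (Tensor r n₂ n₃) :=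
  {B | ∀ i j k, B i j k = 0 ∨ B i j k ∈ Set.range v}

/-- The pairs of factors `(𝒜, ℬ) ∈ 𝔏 × 𝔇` with `0 ≤ (𝒜 ⋄ ℬ)ᵢⱼₖ ≤ c`. The set `Γ` of candidates
consists of the products `𝒜 ⋄ ℬ` of these pairs. -/
def candidates (n₁ n₂ n₃ r : ℕ) (c : ℝ) {t : ℕ} (v w : Fin t → ℝ) :
    Set (Tensor n₁ r n₃ × Tensor r n₂ n₃) :=
  {F | F.1 ∈ factorsA n₁ r n₃ v ∧ F.2 ∈ factorsB r n₂ n₃ w ∧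
    ∀ i j k, 0 ≤ tensorProd F.1 F.2 i j k ∧ tensorProd F.1 F.2 i j k ≤ c}

/-- The objective function `-log p_{𝒳_S}(𝒴_S) + lam * ‖ℬ‖₀` at `𝒳 = 𝒜 ⋄ ℬ`. -/
noncomputable def objective {n₁ n₂ n₃ r : ℕ} (τ lam : ℝ) (S : Set (Index n₁ n₂ n₃))
    (Y : Tensor n₁ n₂ n₃) (F : Tensor n₁ r n₃ × Tensor r n₂ n₃) : ℝ :=
  -Real.log (jointDensity τ S (tensorProd F.1 F.2) Y) + lam * l0Norm F.2

/-- `X` solves the penalized maximum likelihood problem for the observations `Y` on `S`, i.e.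
`X = 𝒜 ⋄ ℬ` for a minimizer `(𝒜, ℬ)` of the objective function over the candidates. -/
def IsEstimate {n₁ n₂ n₃ : ℕ} (r : ℕ) (c τ lam : ℝ) {t : ℕ} (v w : Fin t → ℝ)
    (S : Set (Index n₁ n₂ n₃)) (Y X : Tensor n₁ n₂ n₃) : Prop :=
  ∃ F ∈ candidates n₁ n₂ n₃ r c v w, X = tensorProd F.1 F.2 ∧
    ∀ G ∈ candidates n₁ n₂ n₃ r c v w, objective τ lam S Y F ≤ objective τ lam S Y G

end SparseNTF

open MeasureTheory ProbabilityTheory SparseNTF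

/-! This is a penalized-likelihood argument based on Hellinger affinities and a Kraft inequality.
For a fixed candidate with error `D`, let `L` be the log-likelihood ratio of the truth against it.
Sampling and noise are independent, so the mean of `exp (-L / 2)` is a product over the entries of
`1 - γ + γ * affinity`. The affinity of two Laplace laws is explicit, and the product is at most
`exp (-γ ‖D‖² / (2 (2τ + c)²))` (`integral_exp_neg_half_logLikelihoodRatio_le`).

The minimizer depends on the data, so all candidates are treated at once: the weights `exp (-λ (r n₁
n₃ + ‖ℬ‖₀) / 2)` sum to at most `1` (`sum_candidates_exp_le_one`), and a weighted sum of the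
exponentials dominates the term at the minimizer. Minimality then trades its `L` for that of a fixed
competitor, whose mean is a Kullback-Leibler divergence of order `γ ‖D‖² / τ²`. This gives the
oracle inequality `integral_frobNorm_sq_le`.

The competitor is obtained by rounding the true factors while keeping the zeros of `ℬ*`; `β` is
large enough for its squared error to be at most `c²` (`exists_candidate_near`). -/

namespace SparseNTF

/-! ### Affinity and divergence of Laplace distributions -/

lemma laplacePDF_pos {τ : ℝ} (hτ : 0 < τ) (μ y : ℝ) : 0 < laplacePDF μ τ y := by
  unfold laplacePDF; positivity

@[fun_prop]
lemma measurable_laplacePDF (μ τ : ℝ) : Measurable (laplacePDF μ τ) := by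
  unfold laplacePDF; fun_prop

lemma integral_laplaceMeasure {τ : ℝ} (hτ : 0 < τ) (f : ℝ → ℝ) :
    ∫ x, f x ∂(laplaceMeasure 0 τ) = ∫ x, laplacePDF 0 τ x * f x := by
  unfold laplaceMeasure
  rw [integral_withDensity_eq_integral_toReal_smul (by fun_prop) (by simp)]
  simp [ENNReal.toReal_ofReal (laplacePDF_pos hτ _ _).le]

lemma integral_laplaceMeasure_comp_neg {τ : ℝ} (hτ : 0 < τ) (f : ℝ → ℝ) :
    ∫ x, f (-x) ∂(laplaceMeasure 0 τ) = ∫ x, f x ∂(laplaceMeasure 0 τ) := by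
  rw [integral_laplaceMeasure hτ, integral_laplaceMeasure hτ,
    ← integral_neg_eq_self (fun x => laplacePDF 0 τ x * f x)]
  simp [laplacePDF]

lemma integral_exp_neg_max_abs {τ : ℝ} (hτ : 0 < τ) {a : ℝ} (ha : 0 ≤ a) :
    ∫ x : ℝ, Real.exp (-max a |x| / τ) = 2 * (a + τ) * Real.exp (-a / τ) := by
  rw [integral_comp_abs (f := fun x => Real.exp (-max a x / τ))]
  have h2 : ∀ x ∈ Set.Ioi a, Real.exp (-max a x / τ) = Real.exp ((-τ⁻¹) * x) := by
    intro x hx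
    rw [max_eq_right (le_of_lt hx)]; congr 1; field_simp
  have h1 : ∀ x ∈ Set.Ioc 0 a, Real.exp (-max a x / τ) = Real.exp (-a / τ) := by
    intro x hx
    rw [max_eq_left hx.2]
  have hneg : -τ⁻¹ < 0 := by simpa using hτ
  rw [← Set.Ioc_union_Ioi_eq_Ioi ha,
    setIntegral_union (Set.Ioc_disjoint_Ioi le_rfl) measurableSet_Ioi,
    setIntegral_congr_fun measurableSet_Ioc h1, setIntegral_congr_fun measurableSet_Ioi h2,
    integral_exp_mul_Ioi hneg, setIntegral_const]
  · simp [ha]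
    field_simp
  · exact (integrableOn_congr_fun h1 measurableSet_Ioc).2 (by simp)
  · exact (integrableOn_congr_fun h2 measurableSet_Ioi).2 (integrableOn_exp_mul_Ioi hneg a)

/-- The Hellinger affinity of two Laplace distributions whose locations differ by `d`. -/
lemma integral_exp_half_laplace {τ : ℝ} (hτ : 0 < τ) (d : ℝ) :
    ∫ x, Real.exp (-((|x - d| - |x|) / τ) / 2) ∂(laplaceMeasure 0 τ) =
      (1 + |d| / (2 * τ)) * Real.exp (-(|d| / (2 * τ))) := by
  rw [integral_laplaceMeasure hτ]
  have h : ∀ x : ℝ, laplacePDF 0 τ x * Real.exp (-((|x - d| - |x|) / τ) / 2) =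
      1 / (2 * τ) * Real.exp (-max (|d| / 2) |x - d / 2| / τ) := by
    intro x
    -- The mean distance from `x` to `0` and `d` is constant between these points and equals the
    -- distance to their midpoint outside. The geometric mean of the two densities is thus a plateau
    -- with exponential tails, centred at `d / 2`.
    have hm : max (|d| / 2) |x - d / 2| = (|x| + |x - d|) / 2 := by
      rcases abs_cases d with h | h <;> rcases abs_cases (x - d / 2) with h' | h' <;>
      rcases abs_cases x with h'' | h'' <;> rcases abs_cases (x - d) with h3 | h3 <;>
      rcases max_cases (|d| / 2) |x - d / 2| with h4 | h4 <;> linarith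
    rw [laplacePDF, mul_assoc, ← Real.exp_add, hm]
    congr 2
    simp
    field_simp
    ring
  simp_rw [h]
  rw [integral_const_mul,
    integral_sub_right_eq_self (fun x => Real.exp (-max (|d| / 2) |x| / τ)) (d / 2),
    integral_exp_neg_max_abs hτ (by positivity)]
  rw [show -(|d| / 2) / τ = -(|d| / (2 * τ)) by field_simp]
  field_simp
  ring

lemma isProbabilityMeasure_laplaceMeasure {τ : ℝ} (hτ : 0 < τ) :
    IsProbabilityMeasure (laplaceMeasure 0 τ) := by
  have h : ∫ x, laplacePDF 0 τ x = 1 := by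
    have := integral_exp_neg_max_abs hτ le_rfl
    simp only [abs_nonneg, sup_of_le_right] at this
    simp only [laplacePDF, sub_zero]
    rw [integral_const_mul, this]
    simp
    field_simp
  constructor
  rw [laplaceMeasure, withDensity_apply _ .univ, setLIntegral_univ,
    ← ofReal_integral_eq_lintegral_ofReal, h, ENNReal.ofReal_one]
  · exact integrable_of_integral_eq_one h
  · exact .of_forall fun x => (laplacePDF_pos hτ _ _).le

lemma measureReal_Icc_laplaceMeasure_le {τ : ℝ} (hτ : 0 < τ) {a : ℝ} (ha : 0 ≤ a) :
    (laplaceMeasure 0 τ).real (Set.Icc (-a) a) ≤ a / τ := by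
  refine ENNReal.toReal_le_of_le_ofReal (by positivity) ?_
  rw [laplaceMeasure, withDensity_apply _ measurableSet_Icc]
  calc ∫⁻ x in Set.Icc (-a) a, ENNReal.ofReal (laplacePDF 0 τ x)
      ≤ ∫⁻ _ in Set.Icc (-a) a, ENNReal.ofReal (1 / (2 * τ)) := by
        refine lintegral_mono fun x => ENNReal.ofReal_le_ofReal ?_
        refine mul_le_of_le_one_right (by positivity) (Real.exp_le_one_iff.2 ?_)
        rw [neg_div]; exact neg_nonpos.2 (by positivity)
    _ = ENNReal.ofReal (a / τ) := by
        rw [setLIntegral_const, Real.volume_Icc, ← ENNReal.ofReal_mul (by positivity)]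
        congr 1; field_simp; ring

lemma abs_abs_sub_sub_abs_le (x d : ℝ) : |(|x - d| - |x|)| ≤ |d| := by
  simpa using abs_abs_sub_abs_le (x - d) x

lemma integrable_abs_sub_sub_abs {τ : ℝ} (hτ : 0 < τ) (d : ℝ) :
    Integrable (fun x => |x - d| - |x|) (laplaceMeasure 0 τ) := by
  have := isProbabilityMeasure_laplaceMeasure hτ
  exact Integrable.of_bound (by fun_prop) |d| (.of_forall fun x => abs_abs_sub_sub_abs_le x d)

/-- An upper bound for the Kullback-Leibler divergence of two Laplace distributions, multiplied by
the diversity `τ`. -/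
lemma integral_abs_sub_sub_abs_le {τ : ℝ} (hτ : 0 < τ) (d : ℝ) :
    ∫ x, (|x - d| - |x|) ∂(laplaceMeasure 0 τ) ≤ d ^ 2 / τ := by
  have := isProbabilityMeasure_laplaceMeasure hτ
  have hi := integrable_abs_sub_sub_abs hτ d
  have hi' : Integrable (fun x => |-x - d| - |-x|) (laplaceMeasure 0 τ) := by
    refine (integrable_abs_sub_sub_abs hτ (-d)).congr (.of_forall fun x => ?_)
    dsimp only
    rw [abs_neg, ← abs_neg (-x - d)]
    ring_nf
  have hs := integral_laplaceMeasure_comp_neg hτ (fun x => |x - d| - |x|)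
  -- Symmetrizing in `x` cancels the first-order part: the sum vanishes for `|x| > |d|` and is at
  -- most `2 * |d|` otherwise, an event of probability at most `|d| / τ`.
  have h : ∫ x, ((|x - d| - |x|) + (|-x - d| - |-x|)) ∂(laplaceMeasure 0 τ) ≤
      ∫ x, (Set.Icc (-|d|) |d|).indicator (fun _ => 2 * |d|) x ∂(laplaceMeasure 0 τ) := by
    refine integral_mono (hi.add hi') ((integrable_const _).indicator measurableSet_Icc) fun x => ?_
    by_cases hx : x ∈ Set.Icc (-|d|) |d|
    · rw [Set.indicator_of_mem hx]
      have h1 := (abs_le.1 (abs_abs_sub_sub_abs_le x d)).2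
      have h2 := (abs_le.1 (abs_abs_sub_sub_abs_le (-x) d)).2
      dsimp only
      linarith
    · rw [Set.indicator_of_notMem hx]
      rw [Set.mem_Icc, ← abs_le, not_le] at hx
      dsimp only
      rcases abs_cases d with h | h <;> rcases abs_cases x with h' | h' <;>
      rcases abs_cases (x - d) with h'' | h'' <;> rcases abs_cases (-x - d) with h3 | h3 <;>
      rw [abs_neg x] <;> linarith
  rw [integral_add hi hi', hs, integral_indicator measurableSet_Icc, setIntegral_const,
    smul_eq_mul] at h
  have h4 := mul_le_mul_of_nonneg_right (measureReal_Icc_laplaceMeasure_le hτ (abs_nonneg d))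
    (by positivity : 0 ≤ 2 * |d|)
  have h5 : |d| / τ * (2 * |d|) = 2 * (d ^ 2 / τ) := by
    rw [← sq_abs d]; field_simp
  linarith

/-- From `exp u ≥ 1 + u + u² / 2` the right side is at least `u² / (2 (1 + u + u² / 2))`, and the
inner denominator is at most `(1 + u)²`. -/
lemma sq_le_one_sub_laplace_affinity {u : ℝ} (hu : 0 ≤ u) :
    u ^ 2 / (2 * (1 + u) ^ 2) ≤ 1 - (1 + u) * Real.exp (-u) := by
  have h1 := Real.quadratic_le_exp_of_nonneg hu
  have h2 : Real.exp (-u) ≤ 1 / (1 + u + u ^ 2 / 2) := by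
    rw [Real.exp_neg, ← one_div]
    exact one_div_le_one_div_of_le (by positivity) h1
  have h3 : (1 + u) * Real.exp (-u) ≤ (1 + u) * (1 / (1 + u + u ^ 2 / 2)) := by gcongr
  refine le_trans ?_ (sub_le_sub_left h3 1)
  have : 1 - (1 + u) * (1 / (1 + u + u ^ 2 / 2)) = u ^ 2 / (2 * (1 + u + u ^ 2 / 2)) := by
    field_simp; ring
  rw [this]
  gcongr
  nlinarith

/-- The source of the factor `(2 * τ + c) ^ 2` in the final bound. -/
lemma sq_div_le_one_sub_laplace_affinity {τ c d : ℝ} (hτ : 0 < τ) (hd : |d| ≤ c) :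
    d ^ 2 / (2 * (2 * τ + c) ^ 2) ≤
      1 - (1 + |d| / (2 * τ)) * Real.exp (-(|d| / (2 * τ))) := by
  refine le_trans ?_ (sq_le_one_sub_laplace_affinity (u := |d| / (2 * τ)) (by positivity))
  have : (|d| / (2 * τ)) ^ 2 / (2 * (1 + |d| / (2 * τ)) ^ 2) = d ^ 2 / (2 * (2 * τ + |d|) ^ 2) := by
    rw [← sq_abs d]; field_simp
  rw [this]
  gcongr

/-! ### Bernoulli random sets with independent marks -/

section Expectation

variable {W : Type*} [MeasurableSpace W] {P : Measure W} [IsProbabilityMeasure P]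

/-- Conditioning on a variable with finitely many values: the integrand is split by the indicators
of `S = s`, each independent of `h s ∘ e`. -/
lemma integrable_and_integral_comp_of_indepFun {α E : Type*} [Fintype α] [MeasurableSpace α]
    [MeasurableSingletonClass α] [MeasurableSpace E] {μ : Measure α} {S : W → α} {e : W → E}
    (hS : HasLaw S μ P) (hSe : IndepFun S e P) {h : α → E → ℝ}
    (hm : ∀ s, Measurable (h s)) (hi : ∀ s, Integrable (fun ω => h s (e ω)) P) :
    Integrable (fun ω => h (S ω) (e ω)) P ∧
      ∫ ω, h (S ω) (e ω) ∂P = ∑ s, μ.real {s} * ∫ ω, h s (e ω) ∂P := by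
  classical
  let φ : α → α → ℝ := fun s => Set.indicator {s} 1
  have hφm : ∀ s, Measurable (φ s) := fun s =>
    measurable_one.indicator (measurableSet_singleton s)
  have heq : (fun ω => h (S ω) (e ω)) = fun ω => ∑ s, φ s (S ω) * h s (e ω) := by
    ext ω
    rw [Finset.sum_eq_single (S ω)] <;> simp +contextual [φ, eq_comm]
  have hφi : ∀ s, Integrable (fun ω => φ s (S ω)) P := fun s =>
    Integrable.of_bound ((hφm s).comp_aemeasurable hS.aemeasurable).aestronglyMeasurable 1
      (.of_forall fun ω => by by_cases h : S ω = s <;> simp [φ, h])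
  have hind : ∀ s, IndepFun (fun ω => φ s (S ω)) (fun ω => h s (e ω)) P := fun s =>
    hSe.comp (hφm s) (hm s)
  have hint : ∀ s, Integrable (fun ω => φ s (S ω) * h s (e ω)) P := fun s =>
    (hind s).integrable_mul (hφi s) (hi s)
  rw [heq]
  refine ⟨integrable_finsetSum _ fun s _ => hint s, ?_⟩
  rw [integral_finsetSum _ fun s _ => hint s]
  refine Finset.sum_congr rfl fun s _ => ?_
  rw [(hind s).integral_fun_mul_eq_mul_integral (hφi s).aestronglyMeasurable
    (hi s).aestronglyMeasurable]
  congr 1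
  rw [show (fun ω => φ s (S ω)) = φ s ∘ S from rfl,
    hS.integral_comp (hφm s).aestronglyMeasurable]
  simp only [φ]
  rw [integral_indicator_one (measurableSet_singleton s)]

lemma setBernoulli_real_mem {ι : Type*} [Finite ι] (p : unitInterval) (i : ι) :
    (setBernoulli Set.univ p).real {s : Set ι | i ∈ s} = p := by
  have := Fintype.ofFinite ι
  have h : setBernoulli Set.univ p {s : Set ι | i ∈ s} = Measure.infinitePi
      (fun i : ι => unitInterval.toNNReal p • Measure.dirac (i ∈ Set.univ) +
        unitInterval.toNNReal (unitInterval.symm p) • Measure.dirac False)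
      (cylinder {i} {fun _ => True}) := by
    rw [setBernoulli_apply']; congr!; ext; simp [funext_iff]
  rw [measureReal_def, h, Measure.infinitePi_cylinder]
  · simp
  · simp

/-- Expanding the product on the right over subsets produces exactly the atoms of the Bernoulli law.
-/
lemma sum_setBernoulli_real_mul_prod {ι : Type*} [Fintype ι] [DecidableEq ι] (p : unitInterval)
    (a : ι → ℝ) :
    ∑ s : Finset ι, (setBernoulli (Set.univ : Set ι) p).real {(s : Set ι)} * ∏ i ∈ s, a i =
      ∏ i, (1 - p + p * a i) := by
  have h : ∀ i, 1 - (p : ℝ) + p * a i = p * a i + (1 - p) := fun i => add_comm _ _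
  simp_rw [h]
  rw [Finset.prod_add, Finset.powerset_univ]
  refine Finset.sum_congr rfl fun s _ => ?_
  rw [setBernoulli_real_singleton _ (Set.subset_univ _) Set.finite_univ, Finset.prod_mul_distrib,
    Finset.prod_const, Finset.prod_const, Set.ncard_coe_finset, ← Finset.coe_univ,
    ← Finset.coe_sdiff, Set.ncard_coe_finset]
  ring

open Classical in
/-- The probability generating functional of a Bernoulli random set with independent marks. -/
lemma integrable_and_integral_prod_mem {ι : Type*} [Fintype ι] {p : unitInterval}
    {ν : Measure ℝ} {S : W → Set ι} {e : ι → W → ℝ} (hS : IsSetBernoulli S Set.univ p P)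
    (he : ∀ i, HasLaw (e i) ν P) (hei : iIndepFun e P) (hSe : IndepFun S (fun ω i => e i ω) P)
    {f : ι → ℝ → ℝ} {C : ι → ℝ} (hf : ∀ i, Measurable (f i)) (hC : ∀ i x, |f i x| ≤ C i) :
    Integrable (fun ω => ∏ i with i ∈ S ω, f i (e i ω)) P ∧
      ∫ ω, ∏ i with i ∈ S ω, f i (e i ω) ∂P = ∏ i, (1 - p + p * ∫ x, f i x ∂ν) := by
  have hem : AEMeasurable (fun ω i => e i ω) P := aemeasurable_pi_iff.2 fun i => (he i).aemeasurable
  have hm : ∀ s : Set ι, Measurable fun x : ι → ℝ => ∏ i with i ∈ s, f i (x i) := fun s =>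
    Finset.measurable_prod _ fun i _ => (hf i).comp (measurable_pi_apply i)
  have hb : ∀ s : Set ι, Integrable (fun ω => ∏ i with i ∈ s, f i (e i ω)) P := fun s =>
    Integrable.of_bound ((hm s).comp_aemeasurable hem).aestronglyMeasurable
      (∏ i with i ∈ s, C i) (.of_forall fun ω => by
        rw [Real.norm_eq_abs, Finset.abs_prod]
        exact Finset.prod_le_prod (fun _ _ => abs_nonneg _) fun i _ => hC i _)
  obtain ⟨h1, h2⟩ := integrable_and_integral_comp_of_indepFun hS hSe hm hb
  refine ⟨h1, h2.trans ?_⟩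
  rw [← sum_setBernoulli_real_mul_prod]
  refine (Fintype.sum_equiv Fintype.finsetEquivSet _ _ fun s => ?_).symm
  rw [Fintype.finsetEquivSet_apply]
  congr 1
  have hI : iIndepFun (fun (i : s) ω => f i (e i ω)) P :=
    (hei.comp f hf).precomp (g := fun i : s => (i : ι)) Subtype.val_injective
  have := hI.integral_fun_prod_eq_prod_integral fun i =>
    ((hf i).comp_aemeasurable (he i).aemeasurable).aestronglyMeasurable
  have hs : ∀ ω, ∏ i : s, f i (e i ω) = ∏ i ∈ s, f i (e i ω) := fun ω =>
    Finset.prod_coe_sort s fun i => f i (e i ω)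
  simp only [hs] at this
  simp only [Finset.mem_coe, Finset.filter_univ_mem]
  rw [this, ← Finset.prod_coe_sort s]
  refine Finset.prod_congr rfl fun i _ => ?_
  exact ((he i).integral_comp (hf i).aestronglyMeasurable).symm

open Classical in
lemma integrable_and_integral_sum_mem {ι : Type*} [Fintype ι] {p : unitInterval}
    {ν : Measure ℝ} {S : W → Set ι} {e : ι → W → ℝ} (hS : IsSetBernoulli S Set.univ p P)
    (he : ∀ i, HasLaw (e i) ν P) (hSe : IndepFun S (fun ω i => e i ω) P)
    {f : ι → ℝ → ℝ} (hf : ∀ i, Measurable (f i)) (hfi : ∀ i, Integrable (f i) ν) :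
    Integrable (fun ω => ∑ i with i ∈ S ω, f i (e i ω)) P ∧
      ∫ ω, ∑ i with i ∈ S ω, f i (e i ω) ∂P = p * ∑ i, ∫ x, f i x ∂ν := by
  let φ : ι → Set ι → ℝ := fun i => Set.indicator {s | i ∈ s} 1
  have hφ : ∀ i, Measurable (φ i) := fun i => .of_discrete
  have hfe : ∀ i, Integrable (fun ω => f i (e i ω)) P := fun i =>
    Integrable.comp_aemeasurable (by rw [(he i).map_eq]; exact hfi i) (he i).aemeasurable
  have hφi : ∀ i, Integrable (fun ω => φ i (S ω)) P := fun i =>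
    Integrable.of_bound ((hφ i).comp_aemeasurable hS.aemeasurable).aestronglyMeasurable 1
      (.of_forall fun ω => by by_cases h : i ∈ S ω <;> simp [φ, h])
  have hind : ∀ i, IndepFun (fun ω => φ i (S ω)) (fun ω => f i (e i ω)) P := fun i =>
    hSe.comp (hφ i) ((hf i).comp (measurable_pi_apply i))
  have hint : ∀ i, Integrable (fun ω => φ i (S ω) * f i (e i ω)) P := fun i =>
    (hind i).integrable_mul (hφi i) (hfe i)
  have heq : (fun ω => ∑ i with i ∈ S ω, f i (e i ω)) =
      fun ω => ∑ i, φ i (S ω) * f i (e i ω) := by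
    ext ω
    rw [Finset.sum_filter]
    exact Finset.sum_congr rfl fun i _ => by by_cases h : i ∈ S ω <;> simp [φ, h]
  rw [heq]
  refine ⟨integrable_finsetSum _ fun i _ => hint i, ?_⟩
  rw [integral_finsetSum _ fun i _ => hint i, Finset.mul_sum]
  refine Finset.sum_congr rfl fun i _ => ?_
  rw [(hind i).integral_fun_mul_eq_mul_integral (hφi i).aestronglyMeasurable
    (hfe i).aestronglyMeasurable, ← setBernoulli_real_mem p i]
  congr 1
  · rw [show (fun ω => φ i (S ω)) = φ i ∘ S from rfl,
      hS.integral_comp (hφ i).aestronglyMeasurable]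
    exact integral_indicator_one .of_discrete
  · exact (he i).integral_comp (hf i).aestronglyMeasurable

end Expectation

end SparseNTF

/-! ### Tensor formulas and weighted sums over the candidates -/

namespace SparseNTF

variable {n₁ n₂ n₃ r : ℕ}

lemma tensorProd_apply (A : Tensor n₁ r n₃) (B : Tensor r n₂ n₃) (i : Fin n₁) (j : Fin n₂)
    (k : Fin n₃) :
    tensorProd A B i j k = ∑ q : Fin n₃ × Fin r, A i q.2 (k - q.1) * B q.2 j q.1 := by
  simp [tensorProd, fold, circ, unfold, frontalSlice, Matrix.mul_apply]

lemma frobNorm_sq (X : Tensor n₁ n₂ n₃) :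
    frobNorm X ^ 2 = ∑ q : Index n₁ n₂ n₃, X q.1 q.2.1 q.2.2 ^ 2 := by
  have h : tensorInner X X = ∑ q : Index n₁ n₂ n₃, X q.1 q.2.1 q.2.2 ^ 2 := by
    simp only [tensorInner, Matrix.trace, Matrix.diag, Matrix.mul_apply, Matrix.transpose_apply,
      frontalSlice, Matrix.of_apply, Fintype.sum_prod_type, sq]
    rw [Finset.sum_comm, Finset.sum_congr rfl fun j _ => Finset.sum_comm, Finset.sum_comm]
  rw [frobNorm, h, Real.sq_sqrt (by positivity)]

lemma l0Norm_eq_sum (X : Tensor n₁ n₂ n₃) :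
    l0Norm X = ∑ i, ∑ j, ∑ k, if X i j k = 0 then 0 else 1 := by
  classical
  rw [l0Norm, Set.ncard_eq_toFinset_card', Set.toFinset_ofPred, Finset.card_filter,
    Fintype.sum_prod_type]
  simp [Fintype.sum_prod_type, ite_not]

/-- Distributivity, once per tensor index. With `g` constant it sums the weights of `𝒜`; with `g x =
q ^ (if x = 0 then 0 else 1)` those of `ℬ`. -/
lemma sum_piFinset_prod_eq_pow (V : Finset ℝ) (g : ℝ → ℝ) :
    ∑ T ∈ Fintype.piFinset fun _ : Fin n₁ => Fintype.piFinset fun _ : Fin n₂ =>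
      Fintype.piFinset fun _ : Fin n₃ => V, ∏ i, ∏ j, ∏ k, g (T i j k) =
      (∑ x ∈ V, g x) ^ (n₁ * n₂ * n₃) := by
  rw [← Finset.prod_univ_sum (fun _ : Fin n₁ => Fintype.piFinset fun _ : Fin n₂ =>
    Fintype.piFinset fun _ : Fin n₃ => V) (fun _ T => ∏ j, ∏ k, g (T j k))]
  rw [← Finset.prod_univ_sum (fun _ : Fin n₂ =>
    Fintype.piFinset fun _ : Fin n₃ => V) (fun _ T => ∏ k, g (T k))]
  rw [← Finset.prod_univ_sum (fun _ : Fin n₃ => V) (fun _ x => g x)]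
  simp only [Finset.prod_const, Finset.card_univ, Fintype.card_fin]
  rw [← pow_mul, ← pow_mul]
  congr 1; ring

variable {t : ℕ} (v w : Fin t → ℝ)

lemma factorsA_eq_piFinset : factorsA n₁ r n₃ v =
    (Fintype.piFinset fun _ : Fin n₁ => Fintype.piFinset fun _ : Fin r =>
      Fintype.piFinset fun _ : Fin n₃ => Finset.univ.image v : Finset (Tensor n₁ r n₃)) := by
  ext; simp [factorsA]

lemma factorsB_eq_piFinset : factorsB r n₂ n₃ w =
    (Fintype.piFinset fun _ : Fin r => Fintype.piFinset fun _ : Fin n₂ =>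
      Fintype.piFinset fun _ : Fin n₃ => insert 0 (Finset.univ.image w) :
        Finset (Tensor r n₂ n₃)) := by
  ext; simp [factorsB]

lemma candidates_finite (c : ℝ) : (candidates n₁ n₂ n₃ r c v w).Finite := by
  have hA : (factorsA n₁ r n₃ v).Finite := by
    rw [factorsA_eq_piFinset]; exact Finset.finite_toSet _
  have hB : (factorsB r n₂ n₃ w).Finite := by
    rw [factorsB_eq_piFinset]; exact Finset.finite_toSet _
  exact (hA.prod hB).subset fun F hF => ⟨hF.1, hF.2.1⟩

/-- The weights `q ^ (r n₁ n₃ + ‖ℬ‖₀)` of the candidates have a bounded sum. -/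
lemma sum_candidates_pow_le (c : ℝ) {q : ℝ} (hq : 0 ≤ q) :
    ∑ F ∈ (candidates_finite (n₁ := n₁) (n₂ := n₂) (n₃ := n₃) (r := r) v w c).toFinset,
      q ^ (r * n₁ * n₃ + l0Norm F.2) ≤
      (t * q) ^ (n₁ * r * n₃) * (1 + t * q) ^ (r * n₂ * n₃) := by
  classical
  set VA : Finset ℝ := Finset.univ.image v
  set VB : Finset ℝ := insert 0 (Finset.univ.image w)
  have hcA : (VA.card : ℝ) ≤ t := by
    exact_mod_cast Finset.card_image_le.trans (by simp)
  have hcB : ((Finset.univ.image w).card : ℝ) ≤ t := by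
    exact_mod_cast Finset.card_image_le.trans (by simp)
  set SA : Finset (Tensor n₁ r n₃) := Fintype.piFinset fun _ => Fintype.piFinset fun _ =>
      Fintype.piFinset fun _ => VA
  set SB : Finset (Tensor r n₂ n₃) := Fintype.piFinset fun _ => Fintype.piFinset fun _ =>
      Fintype.piFinset fun _ => VB
  have hA : ∑ A ∈ SA, q ^ (r * n₁ * n₃) ≤ (t * q) ^ (n₁ * r * n₃) := by
    have h := sum_piFinset_prod_eq_pow (n₁ := n₁) (n₂ := r) (n₃ := n₃) VA fun _ => q
    simp only [Finset.prod_const, Finset.card_univ, Fintype.card_fin, ← pow_mul] at h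
    rw [show r * n₁ * n₃ = n₃ * r * n₁ by ring, h]
    refine pow_le_pow_left₀ (by positivity) ?_ _
    rw [Finset.sum_const, nsmul_eq_mul]
    gcongr
  have hB : ∑ B ∈ SB, q ^ l0Norm B ≤ (1 + t * q) ^ (r * n₂ * n₃) := by
    have h := sum_piFinset_prod_eq_pow (n₁ := r) (n₂ := n₂) (n₃ := n₃) VB
      fun x => q ^ (if x = 0 then 0 else 1)
    simp only [Finset.prod_pow_eq_pow_sum, ← l0Norm_eq_sum] at h
    rw [h]
    refine pow_le_pow_left₀ (Finset.sum_nonneg fun _ _ => by positivity) ?_ _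
    have h0 : ∀ x, 0 ≤ q ^ (if x = (0 : ℝ) then 0 else 1) := fun x => by positivity
    rw [← Finset.add_sum_erase VB _ (Finset.mem_insert_self 0 _)]
    simp only [if_true, pow_zero]
    have hsub : VB.erase 0 ⊆ Finset.univ.image w := Finset.erase_insert_subset _ _
    have : ∑ x ∈ VB.erase 0, q ^ (if x = 0 then 0 else 1) = (VB.erase 0).card * q := by
      rw [← nsmul_eq_mul, ← Finset.sum_const]
      exact Finset.sum_congr rfl fun x hx => by simp [Finset.ne_of_mem_erase hx]
    rw [this]
    have hc : ((VB.erase 0).card : ℝ) ≤ t :=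
      le_trans (by exact_mod_cast Finset.card_le_card hsub) hcB
    gcongr
  calc _ ≤ ∑ F ∈ SA ×ˢ SB, q ^ (r * n₁ * n₃ + l0Norm F.2) := by
        refine Finset.sum_le_sum_of_subset_of_nonneg (fun F hF => ?_) fun _ _ _ => by positivity
        have hF' := (Set.Finite.mem_toFinset _).1 hF
        rw [Finset.mem_product]
        have h1 := hF'.1
        have h2 := hF'.2.1
        rw [factorsA_eq_piFinset] at h1
        rw [factorsB_eq_piFinset] at h2
        exact ⟨Finset.mem_coe.1 h1, Finset.mem_coe.1 h2⟩
    _ = (∑ A ∈ SA, q ^ (r * n₁ * n₃)) * ∑ B ∈ SB, q ^ l0Norm B := by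
        rw [Finset.sum_product, Finset.sum_mul_sum]
        simp_rw [pow_add]
    _ ≤ _ := mul_le_mul hA hB (Finset.sum_nonneg fun _ _ => by positivity) (by positivity)

/-- The sum over `ℬ` may exceed `1`; the fixed weight of `𝒜` pays for it. Per pair of inner and
third indices, `(1 + s) ^ n₂ ≤ e ≤ 4` is offset by `s ^ n₁ ≤ 1 / 4`. -/
lemma pow_mul_one_add_pow_le_one {s : ℝ} (hs : 0 ≤ s) (hs4 : s ≤ 1 / 4) (hn₁ : 1 ≤ n₁)
    (hsn : s * n₂ ≤ 1) : s ^ (n₁ * r * n₃) * (1 + s) ^ (r * n₂ * n₃) ≤ 1 := by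
  have h1 : (1 + s) ^ n₂ ≤ 4 := by
    calc (1 + s) ^ n₂ ≤ Real.exp s ^ n₂ := by
          gcongr; linarith [Real.add_one_le_exp s]
      _ = Real.exp (s * n₂) := by rw [← Real.exp_nat_mul, mul_comm]
      _ ≤ Real.exp 1 := Real.exp_le_exp.2 hsn
      _ ≤ 4 := by linarith [Real.exp_one_lt_d9]
  have h2 : s ^ n₁ ≤ 1 / 4 := (pow_le_of_le_one hs (by linarith) (by omega)).trans hs4
  have h3 : s ^ n₁ * (1 + s) ^ n₂ ≤ 1 :=
    (mul_le_mul h2 h1 (by positivity) (by norm_num)).trans (by norm_num)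
  calc s ^ (n₁ * r * n₃) * (1 + s) ^ (r * n₂ * n₃)
      = (s ^ n₁ * (1 + s) ^ n₂) ^ (r * n₃) := by
        rw [mul_pow, ← pow_mul, ← pow_mul]; congr 2 <;> ring
    _ ≤ 1 := pow_le_one₀ (by positivity) h3

/-! ### Number of bins and the Kraft inequality -/

section Parameters

variable {β : ℝ}

lemma two_rpow_mul_logb (hn₁ : 2 ≤ n₁) :
    (2 : ℝ) ^ (β * Real.logb 2 (max n₁ n₂ : ℕ)) = ((max n₁ n₂ : ℕ) : ℝ) ^ β := by
  have h0 : (0 : ℝ) < (max n₁ n₂ : ℕ) := by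
    exact_mod_cast lt_of_lt_of_le (by omega : 0 < n₁) (le_max_left _ _)
  rw [mul_comm, Real.rpow_mul (by norm_num), Real.rpow_logb (by norm_num) (by norm_num) h0]

lemma rpow_le_numBins (hn₁ : 2 ≤ n₁) : ((max n₁ n₂ : ℕ) : ℝ) ^ β ≤ numBins n₁ n₂ β := by
  rw [← two_rpow_mul_logb hn₁, numBins, Nat.cast_pow, ← Real.rpow_natCast]
  exact Real.rpow_le_rpow_of_exponent_le (by norm_num) (Nat.le_ceil _)

lemma numBins_le_two_mul_rpow (hn₁ : 2 ≤ n₁) (hβ : 0 ≤ β) :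
    (numBins n₁ n₂ β : ℝ) ≤ 2 * ((max n₁ n₂ : ℕ) : ℝ) ^ β := by
  have h1 : (1 : ℝ) ≤ (max n₁ n₂ : ℕ) := by
    exact_mod_cast le_trans (by omega : 1 ≤ n₁) (le_max_left _ _)
  have h2 : 0 ≤ β * Real.logb 2 (max n₁ n₂ : ℕ) :=
    mul_nonneg hβ (Real.logb_nonneg (by norm_num) h1)
  rw [← two_rpow_mul_logb hn₁, numBins, Nat.cast_pow, ← Real.rpow_natCast]
  refine (Real.rpow_le_rpow_of_exponent_le (by norm_num) (Nat.ceil_lt_add_one h2).le).trans ?_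
  rw [Real.rpow_add (by norm_num), Real.rpow_one, mul_comm]
  norm_num

lemma sum_candidates_exp_le_one (hn₁ : 2 ≤ n₁) (hβ : 3 ≤ β) {lam : ℝ}
    (hlam : 4 * (β + 2) * Real.log (max n₁ n₂ : ℕ) ≤ lam) (c : ℝ)
    (v w : Fin (numBins n₁ n₂ β) → ℝ) :
    ∑ F ∈ (candidates_finite (n₁ := n₁) (n₂ := n₂) (n₃ := n₃) (r := r) v w c).toFinset,
      Real.exp (-(lam / 2 * (r * n₁ * n₃ + l0Norm F.2))) ≤ 1 := by
  set n : ℝ := ((max n₁ n₂ : ℕ) : ℝ)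
  have hn : 2 ≤ n := Nat.ofNat_le_cast.2 (le_trans hn₁ (le_max_left n₁ n₂))
  have hnn₂ : (n₂ : ℝ) ≤ n := Nat.cast_le.2 (le_max_right n₁ n₂)
  set q := Real.exp (-(lam / 2))
  have hq : q ≤ n ^ (-(2 * (β + 2))) := by
    rw [Real.rpow_def_of_pos (by linarith)]
    exact Real.exp_le_exp.2 (by linarith)
  set s : ℝ := numBins n₁ n₂ β * q
  have hs : s ≤ n ^ (-2 : ℝ) := by
    calc s ≤ (2 * n ^ β) * n ^ (-(2 * (β + 2))) := by
          exact mul_le_mul (numBins_le_two_mul_rpow hn₁ (by linarith)) hq (Real.exp_pos _).le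
            (by positivity)
      _ = 2 * n ^ (-(β + 4)) := by
          rw [mul_assoc, ← Real.rpow_add (by linarith)]; ring_nf
      -- Very crude: only `2 ≤ n` and `3 ≤ β + 4` are needed.
      _ ≤ n * n ^ (-3 : ℝ) := by
          gcongr
          · linarith
          · linarith
      _ = n ^ (-2 : ℝ) := by
          nth_rewrite 1 [← Real.rpow_one n]
          rw [← Real.rpow_add (by linarith)]; norm_num
  have hn2 : n ^ (-2 : ℝ) = 1 / n ^ 2 := by
    rw [Real.rpow_neg (by linarith), one_div]; norm_num
  rw [hn2] at hs
  have hs0 : 0 ≤ s := by positivity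
  have h4 : s ≤ 1 / 4 := hs.trans (one_div_le_one_div_of_le (by norm_num) (by nlinarith))
  have hsn : s * n₂ ≤ 1 := by
    calc s * n₂ ≤ 1 / n ^ 2 * n := by gcongr
      _ = 1 / n := by field_simp
      _ ≤ 1 := by rw [div_le_one (by linarith)]; linarith
  refine le_trans (le_of_eq ?_) ((sum_candidates_pow_le (r := r) (n₃ := n₃) v w c (Real.exp_pos _).le).trans
    (pow_mul_one_add_pow_le_one hs0 h4 (by omega : 1 ≤ n₁) hsn))
  refine Finset.sum_congr rfl fun F _ => ?_
  rw [← Real.exp_nat_mul]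
  push_cast
  ring_nf

end Parameters

/-! ### Rounding the true factors -/

section Quantization

lemma exists_binValue_abs_sub_le {u : ℝ} (hu : 0 < u) (ht : 0 < t) {v : Fin t → ℝ}
    (hv : IsBinValues u t v) {x : ℝ} (hx : 0 ≤ x) (hxu : x ≤ u) :
    ∃ k, |v k - x| ≤ u / t := by
  have ht' : (0 : ℝ) < t := by exact_mod_cast ht
  suffices ∃ k : Fin t, u * k / t ≤ x ∧ x ≤ u * (k + 1) / t by
    obtain ⟨k, h1, h2⟩ := this
    refine ⟨k, abs_le.2 ?_⟩
    have := hv k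
    have h3 : u * (k + 1) / t = u * k / t + u / t := by ring
    constructor <;> linarith
  rcases hxu.lt_or_eq with hlt | rfl
  · have hy : 0 ≤ x * t / u := by positivity
    refine ⟨⟨⌊x * t / u⌋₊, ?_⟩, ?_, ?_⟩
    · rw [Nat.floor_lt hy, div_lt_iff₀ hu]
      nlinarith
    · have := Nat.floor_le hy
      rw [le_div_iff₀ hu] at this
      rw [div_le_iff₀ ht']
      simpa [mul_comm] using this
    · have := (Nat.lt_floor_add_one (x * t / u)).le
      rw [div_le_iff₀ hu] at this
      rw [le_div_iff₀ ht']
      simpa [mul_comm] using this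
  -- At `x = u` the floor would be `t`, one past the last bin.
  · refine ⟨⟨t - 1, by omega⟩, ?_, ?_⟩
    · rw [div_le_iff₀ ht']
      have : ((t - 1 : ℕ) : ℝ) ≤ t := by exact_mod_cast Nat.sub_le _ _
      simpa using mul_le_mul_of_nonneg_left this hu.le
    · rw [le_div_iff₀ ht']
      have : ((t - 1 : ℕ) : ℝ) + 1 = t := by exact_mod_cast Nat.sub_add_cancel ht
      simp [this]

lemma IsBinValues.mem_Icc {u : ℝ} (hu : 0 ≤ u) {v : Fin t → ℝ} (hv : IsBinValues u t v)
    (k : Fin t) : 0 ≤ v k ∧ v k ≤ u := by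
  have ht' : (0 : ℝ) < t := by exact_mod_cast k.pos
  refine ⟨le_trans (by positivity) (hv k).1, (hv k).2.trans ?_⟩
  rw [div_le_iff₀ ht']
  have : (k : ℝ) + 1 ≤ t := by exact_mod_cast k.2
  gcongr

/-- Rounding the factors to bin values, keeping the zeros of the second one. -/
lemma exists_quantization {b : ℝ} (hb : 0 < b) (ht : 0 < t) {v w : Fin t → ℝ}
    (hv : IsBinValues 1 t v) (hw : IsBinValues b t w)
    {A₀ : Tensor n₁ r n₃} {B₀ : Tensor r n₂ n₃}
    (hA₀ : ∀ i j k, 0 ≤ A₀ i j k ∧ A₀ i j k ≤ 1) (hB₀ : ∀ i j k, 0 ≤ B₀ i j k ∧ B₀ i j k ≤ b) :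
    ∃ A ∈ factorsA n₁ r n₃ v, ∃ B ∈ factorsB r n₂ n₃ w, l0Norm B ≤ l0Norm B₀ ∧
      (∀ i j k, 0 ≤ tensorProd A B i j k) ∧
      ∀ i j k, |tensorProd A B i j k - tensorProd A₀ B₀ i j k| ≤ 2 * r * n₃ * b / t := by
  choose kA hkA using fun i j k =>
    exists_binValue_abs_sub_le one_pos ht hv (hA₀ i j k).1 (hA₀ i j k).2
  choose kB hkB using fun i j k =>
    exists_binValue_abs_sub_le hb ht hw (hB₀ i j k).1 (hB₀ i j k).2
  let A : Tensor n₁ r n₃ := fun i j k => v (kA i j k)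
  -- The value chosen for the bin containing `0` need not be `0`, so exact zeros are kept by hand to
  -- preserve sparsity.
  let B : Tensor r n₂ n₃ := fun i j k => if B₀ i j k = 0 then 0 else w (kB i j k)
  have hA : ∀ i j k, 0 ≤ A i j k ∧ A i j k ≤ 1 := fun i j k => hv.mem_Icc zero_le_one _
  have hB : ∀ i j k, 0 ≤ B i j k := fun i j k => by
    simp only [B]; split_ifs
    · exact le_rfl
    · exact (hw.mem_Icc hb.le _).1
  have hBB : ∀ i j k, |B i j k - B₀ i j k| ≤ b / t := fun i j k => by
    simp only [B]; split_ifs with h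
    · rw [h]; simp; positivity
    · exact hkB i j k
  refine ⟨A, fun i j k => ⟨_, rfl⟩, B, fun i j k => ?_, ?_, fun i j k => ?_, fun i j k => ?_⟩
  · simp only [B]; split_ifs
    · exact .inl rfl
    · exact .inr ⟨_, rfl⟩
  · refine Set.ncard_le_ncard (fun q hq h => hq ?_) (Set.toFinite _)
    simp only [B, h, if_true]
  · rw [tensorProd_apply]
    exact Finset.sum_nonneg fun q _ => mul_nonneg (hA _ _ _).1 (hB _ _ _)
  · rw [tensorProd_apply, tensorProd_apply, ← Finset.sum_sub_distrib]
    calc _ ≤ ∑ q : Fin n₃ × Fin r, |A i q.2 (k - q.1) * B q.2 j q.1 -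
            A₀ i q.2 (k - q.1) * B₀ q.2 j q.1| := Finset.abs_sum_le_sum_abs _ _
      _ ≤ ∑ _q : Fin n₃ × Fin r, 2 * (b / t) := by
          refine Finset.sum_le_sum fun q _ => ?_
          set a := A i q.2 (k - q.1)
          set a₀ := A₀ i q.2 (k - q.1)
          set x := B q.2 j q.1
          set x₀ := B₀ q.2 j q.1
          have h1 : |a * (x - x₀)| ≤ 1 * (b / t) := by
            rw [abs_mul, abs_of_nonneg (hA _ _ _).1]
            exact mul_le_mul (hA _ _ _).2 (hBB _ _ _) (abs_nonneg _) zero_le_one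
          have h2 : |(a - a₀) * x₀| ≤ 1 / t * b := by
            rw [abs_mul, abs_of_nonneg (hB₀ _ _ _).1]
            exact mul_le_mul (hkA _ _ _) (hB₀ _ _ _).2 (hB₀ _ _ _).1 (by positivity)
          have h3 : a * x - a₀ * x₀ = a * (x - x₀) + (a - a₀) * x₀ := by ring
          have h4 : 1 / t * b = b / t := by ring
          rw [h3]
          linarith [abs_add_le (a * (x - x₀)) ((a - a₀) * x₀)]
      _ = 2 * r * n₃ * b / t := by
          simp
          ring

/-- The second term in the maximum defining `β` is tuned for this: with `n = max n₁ n₂` it makes the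
number of bins at least `3 r n₃^{3/2} b n / c`. The entrywise error is then at most `2 c / (3 n
√n₃)`, and summing its square over at most `n² n₃` entries gives `4 c² / 9`. -/
lemma quantization_error_sq_le (hn₁ : 2 ≤ n₁) (hn₃ : 1 ≤ n₃) (hr : 1 ≤ r)
    {b c : ℝ} (hb : 0 < b) (hc : 0 < c) :
    (2 * r * n₃ * b / numBins n₁ n₂ (betaParam n₁ n₂ n₃ r b c)) ^ 2 * (n₁ * n₂ * n₃) ≤ c ^ 2 := by
  set n : ℝ := ((max n₁ n₂ : ℕ) : ℝ)
  set β := betaParam n₁ n₂ n₃ r b c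
  have hn : 2 ≤ n := Nat.ofNat_le_cast.2 (le_trans hn₁ (le_max_left n₁ n₂))
  have hn1 : (n₁ : ℝ) ≤ n := Nat.cast_le.2 (le_max_left n₁ n₂)
  have hn2 : (n₂ : ℝ) ≤ n := Nat.cast_le.2 (le_max_right n₁ n₂)
  have h3 : (0 : ℝ) < n₃ := by exact_mod_cast hn₃
  have hr0 : (0 : ℝ) < r := by exact_mod_cast hr
  set x : ℝ := 3 * r * (n₃ : ℝ) ^ (3 / 2 : ℝ) * b / c
  have hx : 0 < x := by positivity
  have hlog : 0 < Real.log n := Real.log_pos (by linarith)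
  have hβ : 1 + Real.log x / Real.log n ≤ β := le_max_right _ _
  have hxn : n * x ≤ n ^ β := by
    calc n * x = n ^ (1 + Real.log x / Real.log n) := by
          rw [Real.rpow_add (by linarith), Real.rpow_one, Real.rpow_def_of_pos (by linarith),
            mul_div_cancel₀ _ hlog.ne', Real.exp_log hx]
      _ ≤ n ^ β := Real.rpow_le_rpow_of_exponent_le (by linarith) hβ
  have ht := hxn.trans (rpow_le_numBins (n₂ := n₂) hn₁)
  have h32 : ((n₃ : ℝ) ^ (3 / 2 : ℝ)) ^ 2 = (n₃ : ℝ) ^ 3 := by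
    rw [← Real.rpow_natCast, ← Real.rpow_mul h3.le]; norm_num
  calc _ ≤ (2 * r * n₃ * b / (n * x)) ^ 2 * (n * n * n₃) := by gcongr
    _ = 4 / 9 * c ^ 2 := by
        have : (n * x) ^ 2 = n ^ 2 * (9 * r ^ 2 * (n₃ : ℝ) ^ 3 * b ^ 2) / c ^ 2 := by
          simp only [x, mul_pow, div_pow, h32]; ring
        rw [div_pow, this]
        field_simp
        ring
    _ ≤ c ^ 2 := by nlinarith [sq_nonneg c]

/-- A candidate which is close to the true tensor and not less sparse. -/
lemma exists_candidate_near (hn₁ : 2 ≤ n₁) (hn₂ : 2 ≤ n₂) (hn₃ : 2 ≤ n₃) (hr : 1 ≤ r)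
    {b c : ℝ} (hb : 0 < b) (hc : 0 < c)
    {v w : Fin (numBins n₁ n₂ (betaParam n₁ n₂ n₃ r b c)) → ℝ}
    (hv : IsBinValues 1 _ v) (hw : IsBinValues b _ w)
    {A₀ : Tensor n₁ r n₃} {B₀ : Tensor r n₂ n₃}
    (hA₀ : ∀ i j k, 0 ≤ A₀ i j k ∧ A₀ i j k ≤ 1) (hB₀ : ∀ i j k, 0 ≤ B₀ i j k ∧ B₀ i j k ≤ b)
    (hc₀ : ∀ i j k, tensorProd A₀ B₀ i j k ≤ c / 2) :
    ∃ G ∈ candidates n₁ n₂ n₃ r c v w, l0Norm G.2 ≤ l0Norm B₀ ∧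
      frobNorm (tensorProd G.1 G.2 - tensorProd A₀ B₀) ^ 2 ≤ c ^ 2 := by
  set t := numBins n₁ n₂ (betaParam n₁ n₂ n₃ r b c)
  have ht : 0 < t := by simp [t, numBins]
  obtain ⟨A, hA, B, hB, hl, h0, hd⟩ := exists_quantization hb ht hv hw hA₀ hB₀
  have he := quantization_error_sq_le (n₂ := n₂) hn₁ (by omega : 1 ≤ n₃) hr hb hc
  set e := 2 * r * n₃ * b / t
  have he0 : 0 ≤ e := by positivity
  have h8 : (4 : ℝ) ≤ n₁ * n₂ * n₃ := by
    exact_mod_cast (by nlinarith [Nat.mul_le_mul hn₁ hn₂] : 4 ≤ n₁ * n₂ * n₃)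
  -- Four entries already give `4 e² ≤ c²`. Since the true entries are at most `c / 2`, the rounded
  -- product stays below `c`.
  have hec : e ≤ c / 2 := by
    refine abs_le_of_sq_le_sq' ?_ (by positivity) |>.2
    nlinarith [sq_nonneg e]
  refine ⟨(A, B), ⟨hA, hB, fun i j k => ⟨h0 i j k, ?_⟩⟩, hl, ?_⟩
  · have := (abs_le.1 (hd i j k)).2
    dsimp only
    linarith [hc₀ i j k]
  · rw [frobNorm_sq]
    calc _ ≤ ∑ _q : Index n₁ n₂ n₃, e ^ 2 := by
          refine Finset.sum_le_sum fun q _ => sq_le_sq.2 ?_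
          rw [abs_of_nonneg he0]
          exact hd _ _ _
      _ = e ^ 2 * (n₁ * n₂ * n₃) := by simp; ring
      _ ≤ c ^ 2 := he

end Quantization

end SparseNTF

/-! ### Likelihood ratios and the oracle inequality -/

namespace SparseNTF

open Classical in
/-- The logarithm of the likelihood ratio of the tensors `X₀` and `X₀ + D`, where `e` is the noise
observed on `S`. -/
noncomputable def logLikelihoodRatio {n₁ n₂ n₃ : ℕ} (τ : ℝ) (S : Set (Index n₁ n₂ n₃))
    (e D : Tensor n₁ n₂ n₃) : ℝ :=
  ∑ q : Index n₁ n₂ n₃ with q ∈ S,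
    (|e q.1 q.2.1 q.2.2 - D q.1 q.2.1 q.2.2| - |e q.1 q.2.1 q.2.2|) / τ

variable {n₁ n₂ n₃ r : ℕ} {τ : ℝ}

lemma logLikelihoodRatio_add_le_of_isEstimate (hτ : 0 < τ) {lam : ℝ}
    {S : Set (Index n₁ n₂ n₃)} {X₀ Y e : Tensor n₁ n₂ n₃}
    (hY : ∀ i j k, (i, j, k) ∈ S → Y i j k = X₀ i j k + e i j k)
    {F G : Tensor n₁ r n₃ × Tensor r n₂ n₃}
    (h : objective τ lam S Y F ≤ objective τ lam S Y G) :
    logLikelihoodRatio τ S e (tensorProd F.1 F.2 - X₀) + lam * l0Norm F.2 ≤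
      logLikelihoodRatio τ S e (tensorProd G.1 G.2 - X₀) + lam * l0Norm G.2 := by
  classical
  -- The last sum does not depend on `F`, so it cancels when two objectives are compared.
  have key : ∀ F : Tensor n₁ r n₃ × Tensor r n₂ n₃, objective τ lam S Y F =
      logLikelihoodRatio τ S e (tensorProd F.1 F.2 - X₀) + lam * l0Norm F.2 +
      ∑ q : Index n₁ n₂ n₃ with q ∈ S,
        (|e q.1 q.2.1 q.2.2| / τ - Real.log (1 / (2 * τ))) := by
    intro F
    rw [objective, jointDensity, Real.log_prod fun q _ => (laplacePDF_pos hτ _ _).ne',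
      logLikelihoodRatio, add_right_comm, ← Finset.sum_add_distrib, ← Finset.sum_neg_distrib]
    congr 1
    refine Finset.sum_congr rfl fun q hq => ?_
    have hqS : (q.1, q.2.1, q.2.2) ∈ S := (Finset.mem_filter.1 hq).2
    rw [laplacePDF, Real.log_mul (by positivity) (Real.exp_ne_zero _), Real.log_exp, hY _ _ _ hqS]
    simp only [Pi.sub_apply]
    rw [show e q.1 q.2.1 q.2.2 - (tensorProd F.1 F.2 q.1 q.2.1 q.2.2 - X₀ q.1 q.2.1 q.2.2) =
      X₀ q.1 q.2.1 q.2.2 + e q.1 q.2.1 q.2.2 - tensorProd F.1 F.2 q.1 q.2.1 q.2.2 by ring]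
    ring
  rw [key F, key G] at h
  linarith

lemma indepFun_index_of_indepFun {W : Type*} [MeasurableSpace W] {P : Measure W}
    {S : W → Set (Index n₁ n₂ n₃)} {e : W → Tensor n₁ n₂ n₃} (hSe : IndepFun S e P) :
    IndepFun S (fun ω (q : Index n₁ n₂ n₃) => e ω q.1 q.2.1 q.2.2) P :=
  have h : Measurable fun (T : Tensor n₁ n₂ n₃) (q : Index n₁ n₂ n₃) => T q.1 q.2.1 q.2.2 := by
    fun_prop
  hSe.comp measurable_id h

section Expectation

variable {W : Type*} [MeasurableSpace W] {P : Measure W} [IsProbabilityMeasure P]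
  {p : unitInterval} {S : W → Set (Index n₁ n₂ n₃)} {e : W → Tensor n₁ n₂ n₃}

lemma integral_exp_neg_half_logLikelihoodRatio_le (hτ : 0 < τ) {c : ℝ}
    (hS : IsSetBernoulli S Set.univ p P)
    (he : ∀ i j k, HasLaw (fun ω => e ω i j k) (laplaceMeasure 0 τ) P)
    (hei : iIndepFun (fun (q : Index n₁ n₂ n₃) ω => e ω q.1 q.2.1 q.2.2) P)
    (hSe : IndepFun S e P) {D : Tensor n₁ n₂ n₃} (hD : ∀ i j k, |D i j k| ≤ c) :
    Integrable (fun ω => Real.exp (-logLikelihoodRatio τ (S ω) (e ω) D / 2)) P ∧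
      ∫ ω, Real.exp (-logLikelihoodRatio τ (S ω) (e ω) D / 2) ∂P ≤
        Real.exp (-(p * frobNorm D ^ 2 / (2 * (2 * τ + c) ^ 2))) := by
  classical
  let f : Index n₁ n₂ n₃ → ℝ → ℝ := fun q x =>
    Real.exp (-((|x - D q.1 q.2.1 q.2.2| - |x|) / τ) / 2)
  have hexp : (fun ω => Real.exp (-logLikelihoodRatio τ (S ω) (e ω) D / 2)) = fun ω =>
      ∏ q with q ∈ S ω, f q (e ω q.1 q.2.1 q.2.2) := by
    ext ω
    simp only [f, logLikelihoodRatio]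
    rw [← Real.exp_sum, ← Finset.sum_neg_distrib, Finset.sum_div]
  obtain ⟨h1, h2⟩ := integrable_and_integral_prod_mem hS
    (fun q : Index n₁ n₂ n₃ => he q.1 q.2.1 q.2.2) hei (indepFun_index_of_indepFun hSe)
    (f := f) (C := fun q => Real.exp (|D q.1 q.2.1 q.2.2| / τ / 2)) (fun q => by fun_prop)
    (fun q x => by
      rw [abs_of_pos (Real.exp_pos _)]
      refine Real.exp_le_exp.2 ?_
      rw [← neg_div]
      gcongr
      linarith [(abs_le.1 (abs_abs_sub_sub_abs_le x (D q.1 q.2.1 q.2.2))).1])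
  rw [hexp]
  refine ⟨h1, h2.le.trans ?_⟩
  rw [frobNorm_sq, Finset.mul_sum, Finset.sum_div, ← Finset.sum_neg_distrib, Real.exp_sum]
  have hp0 := p.2.1
  have hp1 := p.2.2
  refine Finset.prod_le_prod (fun q _ => ?_) fun q _ => ?_
  · have : 0 ≤ ∫ x, f q x ∂(laplaceMeasure 0 τ) := integral_nonneg fun x => (Real.exp_pos _).le
    have := mul_nonneg hp0 this
    linarith
  · simp only [f]
    rw [integral_exp_half_laplace hτ]
    -- Each factor is `1 - p δ ≤ exp (-p δ)`, with `δ` the lower bound for one minus the affinity.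
    refine le_trans ?_ (Real.add_one_le_exp _)
    have := mul_le_mul_of_nonneg_left
      (sq_div_le_one_sub_laplace_affinity hτ (hD q.1 q.2.1 q.2.2)) hp0
    rw [mul_div_assoc]
    linarith

lemma integral_logLikelihoodRatio_le (hτ : 0 < τ)
    (hS : IsSetBernoulli S Set.univ p P)
    (he : ∀ i j k, HasLaw (fun ω => e ω i j k) (laplaceMeasure 0 τ) P)
    (hSe : IndepFun S e P) (D : Tensor n₁ n₂ n₃) :
    Integrable (fun ω => logLikelihoodRatio τ (S ω) (e ω) D) P ∧
      ∫ ω, logLikelihoodRatio τ (S ω) (e ω) D ∂P ≤ p * (frobNorm D ^ 2 / τ ^ 2) := by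
  classical
  obtain ⟨h1, h2⟩ := integrable_and_integral_sum_mem hS
    (fun q : Index n₁ n₂ n₃ => he q.1 q.2.1 q.2.2) (indepFun_index_of_indepFun hSe)
    (f := fun q x => (|x - D q.1 q.2.1 q.2.2| - |x|) / τ) (fun q => by fun_prop)
    (fun q => (integrable_abs_sub_sub_abs hτ _).div_const τ)
  refine ⟨h1, h2.le.trans ?_⟩
  refine mul_le_mul_of_nonneg_left ?_ p.2.1
  rw [frobNorm_sq, Finset.sum_div]
  refine Finset.sum_le_sum fun q _ => ?_
  rw [integral_div, div_le_iff₀ hτ]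
  refine (integral_abs_sub_sub_abs_le hτ _).trans_eq ?_
  field_simp

end Expectation

lemma abs_sub_le_of_mem_candidates {c : ℝ} {t : ℕ} {v w : Fin t → ℝ}
    {F : Tensor n₁ r n₃ × Tensor r n₂ n₃} (hF : F ∈ candidates n₁ n₂ n₃ r c v w)
    {X₀ : Tensor n₁ n₂ n₃} (hX₀ : ∀ i j k, 0 ≤ X₀ i j k ∧ X₀ i j k ≤ c / 2)
    (i : Fin n₁) (j : Fin n₂) (k : Fin n₃) : |(tensorProd F.1 F.2 - X₀) i j k| ≤ c := by
  have h1 := hF.2.2 i j k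
  have h2 := hX₀ i j k
  rw [Pi.sub_apply, Pi.sub_apply, Pi.sub_apply, abs_le]
  constructor <;> linarith

lemma frobNorm_sq_le {D : Tensor n₁ n₂ n₃} {c : ℝ} (hD : ∀ i j k, |D i j k| ≤ c) :
    frobNorm D ^ 2 ≤ n₁ * n₂ * n₃ * c ^ 2 := by
  rw [frobNorm_sq]
  calc _ ≤ ∑ _q : Index n₁ n₂ n₃, c ^ 2 :=
        Finset.sum_le_sum fun q _ => sq_le_sq.2 ((hD _ _ _).trans (le_abs_self c))
    _ = _ := by simp [mul_assoc]

/-- The oracle inequality for the penalized maximum likelihood estimator. -/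
lemma integral_frobNorm_sq_le (hτ : 0 < τ) {c lam : ℝ} (hc : 0 ≤ c) {t : ℕ} {v w : Fin t → ℝ}
    (hkraft : ∑ F ∈ (candidates_finite (n₁ := n₁) (n₂ := n₂) (n₃ := n₃) (r := r) v w c).toFinset,
      Real.exp (-(lam / 2 * (r * n₁ * n₃ + l0Norm F.2))) ≤ 1)
    {X₀ : Tensor n₁ n₂ n₃} (hX₀ : ∀ i j k, 0 ≤ X₀ i j k ∧ X₀ i j k ≤ c / 2)
    {W : Type*} [MeasurableSpace W] {P : Measure W} [IsProbabilityMeasure P]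
    {p : unitInterval} {S : W → Set (Index n₁ n₂ n₃)} {e Y X : W → Tensor n₁ n₂ n₃}
    (hS : IsSetBernoulli S Set.univ p P)
    (he : ∀ i j k, HasLaw (fun ω => e ω i j k) (laplaceMeasure 0 τ) P)
    (hei : iIndepFun (fun (q : Index n₁ n₂ n₃) ω => e ω q.1 q.2.1 q.2.2) P)
    (hSe : IndepFun S e P)
    (hY : ∀ ω i j k, (i, j, k) ∈ S ω → Y ω i j k = X₀ i j k + e ω i j k)
    (hXm : AEMeasurable X P)
    (hX : ∀ᵐ ω ∂P, IsEstimate r c τ lam v w (S ω) (Y ω) (X ω))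
    {G : Tensor n₁ r n₃ × Tensor r n₂ n₃} (hG : G ∈ candidates n₁ n₂ n₃ r c v w) :
    Integrable (fun ω => frobNorm (X ω - X₀) ^ 2) P ∧
      p * ∫ ω, frobNorm (X ω - X₀) ^ 2 ∂P ≤
        (2 * τ + c) ^ 2 * (p * (frobNorm (tensorProd G.1 G.2 - X₀) ^ 2 / τ ^ 2) +
          lam * (r * n₁ * n₃ + l0Norm G.2)) := by
  set D : Tensor n₁ r n₃ × Tensor r n₂ n₃ → Tensor n₁ n₂ n₃ :=
    fun F => tensorProd F.1 F.2 - X₀ with hD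
  set C := (candidates_finite (n₁ := n₁) (n₂ := n₂) (n₃ := n₃) (r := r) v w c).toFinset with hC
  have hCm : ∀ F, F ∈ C ↔ F ∈ candidates n₁ n₂ n₃ r c v w := fun F => Set.Finite.mem_toFinset _
  set pen : Tensor n₁ r n₃ × Tensor r n₂ n₃ → ℝ :=
    fun F => lam / 2 * (r * n₁ * n₃ + l0Norm F.2) with hpen
  set K := 2 * (2 * τ + c) ^ 2 with hK
  have hK0 : 0 < K := by positivity
  -- The first exponent undoes the affinity bound, leaving mean at most `exp (-pen F)` per term;
  -- hence `Z` has mean at most `1` by `hkraft`.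
  let Z : W → ℝ := fun ω => ∑ F ∈ C, Real.exp (p * frobNorm (D F) ^ 2 / K - pen F) *
    Real.exp (-logLikelihoodRatio τ (S ω) (e ω) (D F) / 2)
  have hterm : ∀ F ∈ C, _ := fun F hF => integral_exp_neg_half_logLikelihoodRatio_le hτ hS he hei
    hSe (abs_sub_le_of_mem_candidates ((hCm F).1 hF) hX₀)
  have hZi : Integrable Z P := integrable_finsetSum _ fun F hF => (hterm F hF).1.const_mul _
  have hZ : ∫ ω, Z ω ∂P ≤ 1 := by
    rw [integral_finsetSum _ fun F hF => (hterm F hF).1.const_mul _]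
    refine (Finset.sum_le_sum fun F hF => ?_).trans hkraft
    rw [integral_const_mul]
    refine (mul_le_mul_of_nonneg_left (hterm F hF).2 (Real.exp_pos _).le).trans_eq ?_
    rw [← Real.exp_add]
    congr 1
    ring
  obtain ⟨hLi, hL⟩ := integral_logLikelihoodRatio_le hτ hS he hSe (D G)
  have hint : Integrable (fun ω => frobNorm (X ω - X₀) ^ 2) P := by
    refine Integrable.of_bound ?_ (n₁ * n₂ * n₃ * c ^ 2) ?_
    · simp only [frobNorm_sq]
      refine AEMeasurable.aestronglyMeasurable ?_
      exact (Measurable.comp_aemeasurable (g := fun T : Tensor n₁ n₂ n₃ =>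
        ∑ q : Index n₁ n₂ n₃, (T - X₀) q.1 q.2.1 q.2.2 ^ 2)
        (by simp only [Pi.sub_apply]; fun_prop) hXm)
    · filter_upwards [hX] with ω hω
      obtain ⟨F, hF, hXF, -⟩ := hω
      rw [Real.norm_of_nonneg (sq_nonneg _), hXF]
      exact frobNorm_sq_le (abs_sub_le_of_mem_candidates hF hX₀)
  refine ⟨hint, ?_⟩
  have hpt : ∀ᵐ ω ∂P, p * frobNorm (X ω - X₀) ^ 2 / K ≤
      Z ω + (logLikelihoodRatio τ (S ω) (e ω) (D G) / 2 + (pen G - 1)) := by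
    filter_upwards [hX] with ω hω
    obtain ⟨F, hF, hXF, hmin⟩ := hω
    have h1 := logLikelihoodRatio_add_le_of_isEstimate hτ (hY ω) (hmin G hG)
    have h2 : Real.exp (p * frobNorm (D F) ^ 2 / K - pen F) *
        Real.exp (-logLikelihoodRatio τ (S ω) (e ω) (D F) / 2) ≤ Z ω :=
      Finset.single_le_sum (f := fun F => Real.exp (p * frobNorm (D F) ^ 2 / K - pen F) *
        Real.exp (-logLikelihoodRatio τ (S ω) (e ω) (D F) / 2))
        (fun _ _ => by positivity) ((hCm F).2 hF)
    rw [← Real.exp_add] at h2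
    -- Using `x + 1 ≤ exp x` in place of a logarithm and Jensen's inequality: the `-1` it leaves
    -- cancels the bound `1` on the mean of `Z`.
    have h3 := (Real.add_one_le_exp _).trans h2
    simp only [hpen] at h3 ⊢
    simp only [hD] at h3 ⊢
    rw [hXF]
    linarith
  have hLc : Integrable
      (fun ω => logLikelihoodRatio τ (S ω) (e ω) (D G) / 2 + (pen G - 1)) P :=
    (hLi.div_const 2).add (integrable_const _)
  have hmono := integral_mono_ae ((hint.const_mul (p : ℝ)).div_const K) (hZi.add hLc) hpt
  simp only [Pi.add_apply] at hmono
  rw [integral_div, integral_const_mul, integral_add hZi hLc,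
    integral_add (hLi.div_const 2) (integrable_const _),
    integral_div] at hmono
  simp only [integral_const, probReal_univ, one_smul] at hmono
  rw [div_le_iff₀ hK0] at hmono
  refine hmono.trans ?_
  calc _ ≤ (1 + (p * (frobNorm (D G) ^ 2 / τ ^ 2) / 2 + (pen G - 1))) * K := by gcongr
    _ = _ := by simp only [hpen, hK, hD]; ring

end SparseNTF

/-! ### Assembling the risk bound -/

theorem proposition2
    -- dimensions, rank, and nominal number of observations
    (n₁ n₂ n₃ r m : ℕ) (hn₁ : 2 ≤ n₁) (hn₂ : 2 ≤ n₂) (hn₃ : 2 ≤ n₃)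
    (hr : 1 ≤ r) (hrn : r ≤ min n₁ n₂) (hm : 4 ≤ m) (hmn : m ≤ n₁ * n₂ * n₃)
    (b c τ : ℝ) (hb : 0 < b) (hc : 0 < c) (hτ : 0 < τ)
    -- the true tensor and its factors
    (A₀ : Tensor n₁ r n₃) (B₀ : Tensor r n₂ n₃) (X₀ : Tensor n₁ n₂ n₃)
    (hX₀ : X₀ = tensorProd A₀ B₀)
    (hX₀c : ∀ i j k, 0 ≤ X₀ i j k ∧ X₀ i j k ≤ c / 2)
    (hA₀ : ∀ i j k, 0 ≤ A₀ i j k ∧ A₀ i j k ≤ 1)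
    (hB₀ : ∀ i j k, 0 ≤ B₀ i j k ∧ B₀ i j k ≤ b)
    -- the parameters `β`, `κ`, `λ`
    (β κ lam : ℝ) (hβ : β = betaParam n₁ n₂ n₃ r b c) (hκ : κ = c ^ 2 / (2 * τ ^ 2))
    (hlam : lam = lambdaParam n₁ n₂ β κ)
    -- the values representing the bins of `[0, 1]` and of `[0, b]`
    (v w : Fin (numBins n₁ n₂ β) → ℝ)
    (hv : IsBinValues 1 (numBins n₁ n₂ β) v) (hw : IsBinValues b (numBins n₁ n₂ β) w)
    -- the random sampling set, `Ω ∼ Bern(γ)` with `γ = m / (n₁ n₂ n₃)`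
    {W : Type*} [MeasurableSpace W] (P : Measure W) [IsProbabilityMeasure P]
    (γ : unitInterval) (hγ : (γ : ℝ) = m / (n₁ * n₂ * n₃))
    (Ω : W → Set (Index n₁ n₂ n₃)) (hΩ : IsSetBernoulli Ω Set.univ γ P)
    -- the noise: independent Laplace(0, τ) entries, independent of the sampling set
    (ε : W → Tensor n₁ n₂ n₃)
    (hε : ∀ i j k, HasLaw (fun ω => ε ω i j k) (laplaceMeasure 0 τ) P)
    (hεind : iIndepFun (fun (q : Index n₁ n₂ n₃) ω => ε ω q.1 q.2.1 q.2.2) P)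
    (hΩε : IndepFun Ω ε P)
    -- the observations, constrained on the sampling set only
    (Y : W → Tensor n₁ n₂ n₃)
    (hY : ∀ ω i j k, (i, j, k) ∈ Ω ω → Y ω i j k = X₀ i j k + ε ω i j k)
    -- the estimator
    (X : W → Tensor n₁ n₂ n₃) (hXmeas : AEMeasurable X P)
    (hX : ∀ᵐ ω ∂P, IsEstimate r c τ lam v w (Ω ω) (Y ω) (X ω)) :
    Integrable (fun ω => frobNorm (X ω - X₀) ^ 2) P ∧
    (∫ ω, frobNorm (X ω - X₀) ^ 2 ∂P) / (n₁ * n₂ * n₃) ≤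
      3 * c ^ 2 * (2 * τ + c) ^ 2 * Real.log m / (m * τ ^ 2) +
      2 * (3 + c ^ 2 / τ ^ 2) * (2 * τ + c) ^ 2 * (β + 2) *
        ((r * n₁ * n₃ + l0Norm B₀) / m) * Real.log (max n₁ n₂ : ℕ) := by
  have hNpos : (0 : ℝ) < n₁ * n₂ * n₃ := by
    exact_mod_cast (by positivity : 0 < n₁ * n₂ * n₃)
  have hm0 : (0 : ℝ) < m := by exact_mod_cast (by omega : 0 < m)
  have hmN : (m : ℝ) ≤ n₁ * n₂ * n₃ := by exact_mod_cast hmn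
  have hβ3 : 3 ≤ β := hβ ▸ le_max_left _ _
  have hκ0 : 0 ≤ κ := hκ ▸ by positivity
  have hlog : 0 ≤ Real.log (max n₁ n₂ : ℕ) := Real.log_natCast_nonneg _
  have hlogm : 1 ≤ Real.log m := by
    rw [Real.le_log_iff_exp_le hm0]
    have : (4 : ℝ) ≤ m := by exact_mod_cast hm
    linarith [Real.exp_one_lt_d9]
  -- The Kraft inequality needs only this much of `lam`; the factor `1 + 2 * κ / 3` is slack there.
  have hlam' : 4 * (β + 2) * Real.log (max n₁ n₂ : ℕ) ≤ lam := by
    rw [hlam, lambdaParam]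
    have : 0 ≤ 4 * (β + 2) * Real.log (max n₁ n₂ : ℕ) := by positivity
    nlinarith
  have hlam0 : 0 ≤ lam := le_trans (by positivity) hlam'
  obtain ⟨G, hG, hGl, hGd⟩ : ∃ G ∈ candidates n₁ n₂ n₃ r c v w, l0Norm G.2 ≤ l0Norm B₀ ∧
      frobNorm (tensorProd G.1 G.2 - X₀) ^ 2 ≤ c ^ 2 := by
    subst hβ hX₀
    exact exists_candidate_near hn₁ hn₂ hn₃ hr hb hc hv hw hA₀ hB₀ fun i j k => (hX₀c i j k).2
  obtain ⟨hint, hle⟩ := integral_frobNorm_sq_le hτ hc.le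
    (sum_candidates_exp_le_one hn₁ hβ3 hlam' c v w) hX₀c hΩ hε hεind hΩε hY hXmeas hX hG
  refine ⟨hint, ?_⟩
  set I := ∫ ω, frobNorm (X ω - X₀) ^ 2 ∂P
  set L := Real.log (max n₁ n₂ : ℕ)
  have hGl' : (l0Norm G.2 : ℝ) ≤ l0Norm B₀ := by exact_mod_cast hGl
  have hI : I / (n₁ * n₂ * n₃) = γ * I / m := by rw [hγ]; field_simp
  rw [hI, div_le_iff₀ hm0]
  have hγ0 : (0 : ℝ) ≤ γ := γ.2.1
  have hγ1 : (γ : ℝ) ≤ 1 := γ.2.2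
  calc γ * I ≤ (2 * τ + c) ^ 2 * (γ * (frobNorm (tensorProd G.1 G.2 - X₀) ^ 2 / τ ^ 2) +
          lam * (r * n₁ * n₃ + l0Norm G.2)) := hle
    _ ≤ (2 * τ + c) ^ 2 * (1 * (c ^ 2 / τ ^ 2) + lam * (r * n₁ * n₃ + l0Norm B₀)) := by gcongr
    -- Pure loss to reach the stated constants: `1 ≤ 3 * log m`, and `3 / 2 * 4 * (1 + 2 * κ / 3) =
    -- 2 * (3 + c ^ 2 / τ ^ 2)`.
    _ ≤ (2 * τ + c) ^ 2 * (3 * Real.log m * (c ^ 2 / τ ^ 2) +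
          3 / 2 * (lam * (r * n₁ * n₃ + l0Norm B₀))) := by
        have : 0 ≤ lam * (r * n₁ * n₃ + l0Norm B₀) := by positivity
        refine mul_le_mul_of_nonneg_left (add_le_add ?_ ?_) (by positivity)
        · gcongr
          linarith
        · linarith
    _ = _ := by
        rw [hlam, lambdaParam, hκ]
        field_simp
        ring
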